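/- Let $F_2=\langle s_1,s_2\rangle$ be the free group on two generators, let $\Lambda\le F_2$ be the subgroup generated by the elements $s_2^{\,n}s_1s_2^{-n}$, $n\in\mathbb{N}$, and let $\Gamma_0:=F_2*_\Lambda F_2$ be the amalgamated free product of two copies of $F_2$ over $\Lambda$. For a discrete group $\Gamma$ let $\mathbb{Z}$, $\mathbb{Z}^n$ and the countable direct sum $\mathbb{Z}^{\oplus\infty}$ carry the trivial $\Gamma$-action, identify $\mathbb{Z}^m$ with $\mathbb{Z}^m\oplus\{0\}\subseteq\mathbb{Z}^n$ for $m\le n$, and identify each $\mathbb{Z}^n$ with the subgroup of $\mathbb{Z}^{\oplus\infty}$ given by the first $n$ coordinates, so that $\mathbb{Z}^{\oplus\infty}=\bigcup_n\mathbb{Z}^n$. Say that $\Gamma$ has property (Z) if for every finite subset $F\subset\Gamma$ there is a $2$-cocycle $\psi:\Gamma\times\Gamma\to\mathbb{Z}$ that is not a coboundary and satisfies $\psi|_{F\times F}=0$. 1. The group $\Gamma_0$ is finitely generated and has property (Z). 2. For every finitely generated group $\Gamma$ with property (Z), in particular for $\Gamma=\Gamma_0$, the canonical homomorphism $$\varinjlim_n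 \mathrm{H}^2(\Gamma,\mathbb{Z}^n)\to \mathrm{H}^2(\Gamma,\mathbb{Z}^{\oplus\infty})$$ induced by the inclusions $\mathbb{Z}^n\subseteq\mathbb{Z}^{\oplus\infty}$ is not surjective. In particular, $\mathrm{H}^2(\Gamma,\mathbb{Z}^{\oplus\infty})$ is not the direct limit of the groups $\mathrm{H}^2(\Gamma,\mathbb{Z}^n)$ under the maps induced by these inclusions. -/

import Mathlib

open CategoryTheory

noncomputable section

namespace AmalgamCohomology

/-! ### The group `Γ = F₂ *_Λ F₂` -/

/-- The free group `F₂ = ⟨s₁, s₂⟩`; its generators are `s₁ = FreeGroup.of 0` and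
`s₂ = FreeGroup.of 1`. -/
abbrev F₂ : Type := FreeGroup (Fin 2)

/-- The subgroup `Λ` of `F₂` generated by the conjugates `s₂ⁿ s₁ s₂⁻ⁿ`, `n ∈ ℕ`. -/
def Lam : Subgroup F₂ :=
  Subgroup.closure (Set.range fun n : ℕ =>
    (FreeGroup.of 1 : F₂) ^ n * FreeGroup.of 0 * ((FreeGroup.of 1 : F₂) ^ n)⁻¹)

/-- The amalgamated product `Γ = F₂ *_Λ F₂` of two copies of `F₂` over `Λ`. -/
abbrev Gam : Type := Monoid.PushoutI (fun _ : Fin 2 => Lam.subtype)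

/-! ### Cocycles that vanish on large finite sets -/

/-- For every finite `F ⊆ Γ` there is a 2-cocycle `ψ : Γ × Γ → ℤ` (trivial action on `ℤ`)
that is not a coboundary and vanishes on `F × F`. -/
def HasLocallyZeroCocycles (Γ : Type) [Group Γ] : Prop :=
  ∀ F : Set Γ, F.Finite →
    ∃ ψ ∈ groupCohomology.cocycles₂ (Rep.trivial ℤ Γ ℤ),
      ψ ∉ groupCohomology.coboundaries₂ (Rep.trivial ℤ Γ ℤ) ∧
      ∀ g ∈ F, ∀ h ∈ F, ψ (g, h) = 0

/-! ### The coefficient groups -/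

/-- The inclusion `ℤᵐ ≅ ℤᵐ ⊕ 0 ⊆ ℤⁿ` as the initial coordinates, for `m ≤ n`. -/
def inclFin (m n : ℕ) (_ : m ≤ n) : (Fin m → ℤ) →ₗ[ℤ] (Fin n → ℤ) where
  toFun v i := if h : (i : ℕ) < m then v ⟨i, h⟩ else 0
  map_add' v w := by
    funext i; by_cases h : (i : ℕ) < m <;> simp [h]
  map_smul' c v := by
    funext i; by_cases h : (i : ℕ) < m <;> simp [h]

/-- The inclusion of `ℤⁿ` into `ℤ^{⊕∞}` as the initial coordinates. -/
def inclInf (n : ℕ) : (Fin n → ℤ) →ₗ[ℤ] (ℕ →₀ ℤ) :=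
  Finsupp.lmapDomain ℤ ℤ (Fin.val : Fin n → ℕ) ∘ₗ
    (Finsupp.linearEquivFunOnFinite ℤ ℤ (Fin n)).symm.toLinearMap

theorem inclInf_apply (n : ℕ) (v : Fin n → ℤ) (i : ℕ) :
    inclInf n v i = if h : i < n then v ⟨i, h⟩ else 0 := by
  unfold inclInf
  split_ifs with h
  · have := Finsupp.mapDomain_apply (Fin.val_injective (n := n))
      ((Finsupp.linearEquivFunOnFinite ℤ ℤ (Fin n)).symm v) ⟨i, h⟩
    simpa using this
  · have : i ∉ Set.range (Fin.val : Fin n → ℕ) := by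
      rintro ⟨j, rfl⟩; exact h j.2
    simpa using Finsupp.mapDomain_of_notMem_range
      ((Finsupp.linearEquivFunOnFinite ℤ ℤ (Fin n)).symm v) i this

theorem inclInf_comp_inclFin (m n : ℕ) (h : m ≤ n) :
    inclInf n ∘ₗ inclFin m n h = inclInf m := by
  ext1 i
  ext j
  simp only [LinearMap.comp_apply, inclInf_apply, inclFin, LinearMap.coe_mk, AddHom.coe_mk]
  by_cases hj : j < m
  · simp [hj, hj.trans_le h]
  · simp [hj]

/-! ### Cohomology with trivial coefficients and the direct limit map -/

variable (Γ : Type) [Group Γ] (p : ℕ)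

/-- `Hᵖ(Γ, V)` for an abelian group `V` with the trivial action of `Γ`. -/
abbrev H (V : Type) [AddCommGroup V] [Module ℤ V] : Type :=
  groupCohomology (Rep.trivial ℤ Γ V) p

variable {V W U : Type} [AddCommGroup V] [Module ℤ V] [AddCommGroup W] [Module ℤ W]
  [AddCommGroup U] [Module ℤ U]

/-- The map `Hᵖ(Γ, V) → Hᵖ(Γ, W)` induced by a homomorphism `V → W` of trivial modules. -/
def Hmap (f : V →ₗ[ℤ] W) : H Γ p V →ₗ[ℤ] H Γ p W :=
  ((Rep.trivialFunctor ℤ Γ ⋙ groupCohomology.functor ℤ Γ p).map (ModuleCat.ofHom f)).hom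

theorem Hmap_comp_apply (g : W →ₗ[ℤ] U) (f : V →ₗ[ℤ] W) (x : H Γ p V) :
    Hmap Γ p g (Hmap Γ p f x) = Hmap Γ p (g ∘ₗ f) x := by
  unfold Hmap
  rw [ModuleCat.ofHom_comp, Functor.map_comp]
  rfl

/-- The canonical map `lim_{n→} Hᵖ(Γ, ℤⁿ) → Hᵖ(Γ, ℤ^{⊕∞})` induced by the inclusions
`ℤⁿ ⊆ ℤ^{⊕∞}`, the transition maps being induced by the inclusions `ℤᵐ ⊆ ℤⁿ`, `m ≤ n`. -/
def directLimitMap :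
    Module.DirectLimit (fun n : ℕ => H Γ p (Fin n → ℤ))
      (fun m n h => Hmap Γ p (inclFin m n h)) →+ H Γ p (ℕ →₀ ℤ) :=
  (Module.DirectLimit.lift ℤ ℕ _ _ (fun n => Hmap Γ p (inclInf n)) fun m n h x => by
    rw [Hmap_comp_apply, inclInf_comp_inclFin]).toAddMonoidHom

end AmalgamCohomology

end

namespace AmalgamCohomology

/-! ### Locally zero cocycles give classes outside the direct limit -/

/-! Non-surjectivity: exhaust the countable group by finite sets and take non-coboundaries `ψ n`
vanishing on the `n`-th one. At each pair only finitely many are nonzero, so together they form a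
cocycle in `ℕ →₀ ℤ`. A class coming from some `Fin n → ℤ` has trivial `n`-th coordinate, whereas
this one has the class of `ψ n` (`not_surjective_directLimitMap`).

For `Gam`, it suffices to embed `ℕ →₀ ℤ` linearly in cocycles modulo coboundaries: restriction to `F
× F` has finite rank, hence a nonzero kernel. The cocycles come from a central extension of
triangular matrices over `ℤ[T;T⁻¹]`, pulled back to `Gam`. Their asymmetry on the commuting pairs
`torusElt n`, `gen 0 0` detects every coordinate. -/

theorem Hmap_H2π_apply (Γ : Type) [Group Γ] {V W : Type} [AddCommGroup V] [AddCommGroup W]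
    (f : V →ₗ[ℤ] W) (x : groupCohomology.cocycles₂ (Rep.trivial ℤ Γ V))
    (y : groupCohomology.cocycles₂ (Rep.trivial ℤ Γ W)) (h : ∀ g, y g = f (x g)) :
    Hmap Γ 2 f (groupCohomology.H2π _ x) = groupCohomology.H2π _ y := by
  have hxy : groupCohomology.mapCocycles₂ (MonoidHom.id Γ)
      ((Rep.trivialFunctor ℤ Γ).map (ModuleCat.ofHom f)) x = y :=
    DFunLike.ext _ _ fun g => (h g).symm
  have hmap := congr($(groupCohomology.H2π_comp_map (MonoidHom.id Γ)
    ((Rep.trivialFunctor ℤ Γ).map (ModuleCat.ofHom f))).hom x)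
  exact hmap.trans (congrArg (groupCohomology.H2π _).hom hxy)

theorem Hmap_zero (Γ : Type) [Group Γ] (p : ℕ) {V W : Type} [AddCommGroup V] [AddCommGroup W] :
    Hmap Γ p (0 : V →ₗ[ℤ] W) = 0 := by
  have h : (Rep.trivialFunctor ℤ Γ).map (ModuleCat.ofHom (0 : V →ₗ[ℤ] W)) = 0 := rfl
  unfold Hmap
  rw [Functor.comp_map, h, Functor.map_zero]
  rfl

theorem trivial_mem_cocycles₂_iff {Γ : Type} [Group Γ] {V : Type} [AddCommGroup V]
    (f : Γ × Γ → V) : f ∈ groupCohomology.cocycles₂ (Rep.trivial ℤ Γ V) ↔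
      ∀ g h j : Γ, f (g * h, j) + f (g, h) = f (h, j) + f (g, h * j) :=
  groupCohomology.mem_cocycles₂_iff (A := Rep.trivial ℤ Γ V) f

/-- Coordinates start at `0`, so `n` is the first one outside `Fin n`. -/
theorem lapply_comp_inclInf (n : ℕ) : Finsupp.lapply n ∘ₗ inclInf n = 0 := by
  refine LinearMap.ext fun v => ?_
  simp [inclInf_apply]

/-- A class in the image of the direct limit is killed by all but finitely many coordinates. -/
theorem exists_Hmap_lapply_eq_zero (Γ : Type) [Group Γ] (p : ℕ)
    (y : Module.DirectLimit (fun n : ℕ => H Γ p (Fin n → ℤ))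
      (fun m n h => Hmap Γ p (inclFin m n h))) :
    ∃ n, Hmap Γ p (Finsupp.lapply n) (directLimitMap Γ p y) = 0 := by
  obtain ⟨n, x, rfl⟩ := Module.DirectLimit.exists_of y
  refine ⟨n, ?_⟩
  have h : directLimitMap Γ p (Module.DirectLimit.of ℤ ℕ _ _ n x) = Hmap Γ p (inclInf n) x := by
    simp [directLimitMap]
  rw [h, Hmap_comp_apply, lapply_comp_inclInf, Hmap_zero, LinearMap.zero_apply]

theorem not_surjective_directLimitMap (Γ : Type) [Group Γ] [Countable Γ]
    (hΓ : HasLocallyZeroCocycles Γ) : ¬ Function.Surjective (directLimitMap Γ 2) := by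
  intro hsurj
  obtain ⟨e, he⟩ := exists_injective_nat Γ
  have hfin (n : ℕ) : {g : Γ | e g ≤ n}.Finite := (Set.finite_Iic n).preimage he.injOn
  choose ψ hψ hψ' hψ0 using fun n => hΓ {g | e g ≤ n} (hfin n)
  -- Once `n` reaches both indices, the pair lies in the set where `ψ n` vanishes.
  let Ψ : Γ × Γ → (ℕ →₀ ℤ) := fun g => Finsupp.onFinset (Finset.range (max (e g.1) (e g.2)))
    (fun n => ψ n g) fun n hn => by
      by_contra h
      rw [Finset.mem_range, not_lt, max_le_iff] at h
      exact hn (hψ0 n g.1 h.1 g.2 h.2)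
  have hΨ : Ψ ∈ groupCohomology.cocycles₂ (Rep.trivial ℤ Γ (ℕ →₀ ℤ)) :=
    (trivial_mem_cocycles₂_iff Ψ).2 fun g h j =>
      Finsupp.ext fun n => (trivial_mem_cocycles₂_iff (ψ n)).1 (hψ n) g h j
  obtain ⟨y, hy⟩ := hsurj (groupCohomology.H2π _ ⟨Ψ, hΨ⟩)
  obtain ⟨n, hn⟩ := exists_Hmap_lapply_eq_zero Γ 2 y
  rw [hy, Hmap_H2π_apply Γ _ _ ⟨ψ n, hψ n⟩ fun _ => rfl,
    groupCohomology.H2π_eq_zero_iff] at hn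
  exact hψ' n hn

/-! ### Groups with infinitely many independent classes -/

/-- Since `ℤ` is Noetherian, an injection would make `ℕ →₀ ℤ` finitely generated. -/
theorem exists_ne_zero_of_finite_codomain {κ : Type} [Finite κ]
    (f : (ℕ →₀ ℤ) →ₗ[ℤ] (κ → ℤ)) : ∃ x ≠ 0, f x = 0 := by
  by_contra! h
  have hf : Function.Injective f := (injective_iff_map_eq_zero f).2 fun x hx => by
    by_contra h0
    exact h x h0 hx
  have := Module.Finite.of_injective f hf
  have := Module.Finite.finite_basis (Finsupp.basisSingleOne (R := ℤ) (ι := ℕ))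
  exact not_finite ℕ

theorem hasLocallyZeroCocycles_of_linearMap {Γ : Type} [Group Γ]
    (Ψ : (ℕ →₀ ℤ) →ₗ[ℤ] (Γ × Γ → ℤ))
    (hΨ : ∀ x, Ψ x ∈ groupCohomology.cocycles₂ (Rep.trivial ℤ Γ ℤ))
    (hΨ' : ∀ x, Ψ x ∈ groupCohomology.coboundaries₂ (Rep.trivial ℤ Γ ℤ) → x = 0) :
    HasLocallyZeroCocycles Γ := by
  intro F hF
  have := hF.to_subtype
  obtain ⟨x, hx, h⟩ := exists_ne_zero_of_finite_codomain
    (LinearMap.funLeft ℤ ℤ (fun p : F × F => ((p.1 : Γ), (p.2 : Γ))) ∘ₗ Ψ)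
  exact ⟨Ψ x, hΨ x, fun hc => hx (hΨ' x hc), fun g hg k hk => congrFun h (⟨g, hg⟩, ⟨k, hk⟩)⟩

/-- A 2-coboundary with trivial coefficients is symmetric on commuting pairs. -/
theorem apply_comm_of_mem_coboundaries₂ {Γ V : Type} [Group Γ] [AddCommGroup V] {f : Γ × Γ → V}
    (hf : f ∈ groupCohomology.coboundaries₂ (Rep.trivial ℤ Γ V)) {g h : Γ} (hgh : Commute g h) :
    f (g, h) = f (h, g) := by
  obtain ⟨c, rfl⟩ := hf
  change c h - c (g * h) + c g = c g - c (h * g) + c h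
  rw [hgh.eq]
  abel

/-! ### A group of triangular matrices -/

/-- The matrices `!![1, row, *; 0, diag, col; 0, 0, 1]` over `R`, modulo the central entry `*`. -/
@[ext] structure TriMat (R : Type) [CommRing R] where
  /-- the middle diagonal entry -/
  diag : Rˣ
  /-- the entry in the first row and second column -/
  row : R
  /-- the entry in the second row and third column -/
  col : R

namespace TriMat

variable {R : Type} [CommRing R]

instance : Mul (TriMat R) :=
  ⟨fun a b => ⟨a.diag * b.diag, a.row * b.diag + b.row, a.col + a.diag * b.col⟩⟩

instance : One (TriMat R) := ⟨⟨1, 0, 0⟩⟩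

instance : Inv (TriMat R) :=
  ⟨fun a => ⟨a.diag⁻¹, -(a.row * ↑a.diag⁻¹), -(↑a.diag⁻¹ * a.col)⟩⟩

@[simp] theorem diag_mul (a b : TriMat R) : (a * b).diag = a.diag * b.diag := rfl
@[simp] theorem row_mul (a b : TriMat R) : (a * b).row = a.row * b.diag + b.row := rfl
@[simp] theorem col_mul (a b : TriMat R) : (a * b).col = a.col + a.diag * b.col := rfl
@[simp] theorem diag_one : (1 : TriMat R).diag = 1 := rfl
@[simp] theorem row_one : (1 : TriMat R).row = 0 := rfl
@[simp] theorem col_one : (1 : TriMat R).col = 0 := rfl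
@[simp] theorem diag_inv (a : TriMat R) : a⁻¹.diag = a.diag⁻¹ := rfl
@[simp] theorem row_inv (a : TriMat R) : a⁻¹.row = -(a.row * ↑a.diag⁻¹) := rfl
@[simp] theorem col_inv (a : TriMat R) : a⁻¹.col = -(↑a.diag⁻¹ * a.col) := rfl

instance : Group (TriMat R) :=
  Group.ofLeftAxioms
    (fun a b c => TriMat.ext (mul_assoc _ _ _)
      (by simp only [row_mul, diag_mul, Units.val_mul]; ring)
      (by simp only [col_mul, diag_mul, Units.val_mul]; ring))
    (fun a => TriMat.ext (one_mul _) (by simp) (by simp))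
    (fun a => TriMat.ext (inv_mul_cancel _) (by simp) (by simp))

/-- The cocycle of the central extension of `TriMat R` by the corner entry. -/
def cornerCocycle (a b : TriMat R) : R := a.row * b.col

theorem cornerCocycle_mul_left (a b c : TriMat R) :
    cornerCocycle (a * b) c + cornerCocycle a b = cornerCocycle b c + cornerCocycle a (b * c) := by
  simp only [cornerCocycle, row_mul, col_mul]
  ring

theorem mk_zero_col_pow (t : Rˣ) (r : R) (n : ℕ) :
    (⟨t, r, 0⟩ : TriMat R) ^ n = ⟨t ^ n, r * ∑ i ∈ Finset.range n, (t : R) ^ i, 0⟩ := by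
  induction n with
  | zero => ext <;> simp
  | succ n ih =>
    rw [pow_succ, ih]
    ext
    · simp [pow_succ]
    · simp [geom_sum_succ]
      ring
    · simp

/-- Only the discarded corner entry would depend on `r`. Hence representations with different `r`
agree on `Lam` and glue over the amalgam. -/
theorem mk_zero_col_pow_conj (t : Rˣ) (r : R) (n : ℕ) :
    (⟨t, r, 0⟩ : TriMat R) ^ n * ⟨1, 0, 1⟩ * ((⟨t, r, 0⟩ : TriMat R) ^ n)⁻¹ =
      ⟨1, 0, ↑(t ^ n)⟩ := by
  rw [mk_zero_col_pow]
  ext <;> simp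

end TriMat

/-! ### The group `Gam` -/

theorem s₂_conj_mem_Lam (n : ℕ) :
    (FreeGroup.of 1 : F₂) ^ n * FreeGroup.of 0 * ((FreeGroup.of 1 : F₂) ^ n)⁻¹ ∈ Lam :=
  Subgroup.subset_closure ⟨n, rfl⟩

theorem of_eq_of_of_mem_Lam {g : F₂} (hg : g ∈ Lam) (i j : Fin 2) :
    (Monoid.PushoutI.of i g : Gam) = Monoid.PushoutI.of j g :=
  (Monoid.PushoutI.of_apply_eq_base (fun _ : Fin 2 => Lam.subtype) i ⟨g, hg⟩).trans
    (Monoid.PushoutI.of_apply_eq_base (fun _ : Fin 2 => Lam.subtype) j ⟨g, hg⟩).symm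

/-- The generators of `Gam`: the `j`-th generator of the `i`-th copy of `F₂`. -/
def gen (i j : Fin 2) : Gam := Monoid.PushoutI.of i (FreeGroup.of j)

theorem fg_Gam : Group.FG Gam := by
  refine Group.fg_iff.2 ⟨Set.range fun p : Fin 2 × Fin 2 => gen p.1 p.2, ?_, Set.finite_range _⟩
  rw [eq_top_iff]
  have hof (i : Fin 2) (g : F₂) : (Monoid.PushoutI.of i g : Gam) ∈
      Subgroup.closure (Set.range fun p : Fin 2 × Fin 2 => gen p.1 p.2) := by
    induction g using FreeGroup.induction_on with
    | C1 => rw [map_one]; exact one_mem _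
    | of j => exact Subgroup.subset_closure ⟨(i, j), rfl⟩
    | inv_of j h => rw [map_inv]; exact inv_mem h
    | mul x y hx hy => rw [map_mul]; exact mul_mem hx hy
  rintro x -
  induction x using Monoid.PushoutI.induction_on with
  | of i g => exact hof i g
  | base h =>
    rw [← Monoid.PushoutI.of_apply_eq_base (fun _ : Fin 2 => Lam.subtype) 0]
    exact hof _ _
  | mul x y hx hy => exact mul_mem hx hy

/-- The element `b⁻ⁿ aⁿ`, where `a` and `b` are the two copies of `s₂`. -/
def torusElt (n : ℕ) : Gam := (gen 1 1 ^ n)⁻¹ * gen 0 1 ^ n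

/-- The copies `a`, `b` of `s₂` conjugate the shared `s₁` alike: `aⁿ s₁ a⁻ⁿ = bⁿ s₁ b⁻ⁿ`. So `b⁻ⁿ
aⁿ` centralizes `s₁`. -/
theorem commute_torusElt (n : ℕ) : Commute (torusElt n) (gen 0 0) := by
  have h0 : gen 1 0 = gen 0 0 :=
    of_eq_of_of_mem_Lam (by simpa using s₂_conj_mem_Lam 0) 1 0
  have hn : gen 1 1 ^ n * gen 1 0 * (gen 1 1 ^ n)⁻¹ = gen 0 1 ^ n * gen 0 0 * (gen 0 1 ^ n)⁻¹ := by
    simpa [gen] using of_eq_of_of_mem_Lam (s₂_conj_mem_Lam n) 1 0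
  rw [h0] at hn
  have h : gen 0 1 ^ n * gen 0 0 = gen 1 1 ^ n * gen 0 0 * (gen 1 1 ^ n)⁻¹ * gen 0 1 ^ n := by
    rw [hn, inv_mul_cancel_right]
  rw [commute_iff_eq, torusElt, mul_assoc, h]
  group

/-! ### Triangular representations of `Gam` and the cocycles they induce -/

section Representation

variable {R : Type} [CommRing R]

/-- The homomorphism of `F₂` to triangular matrices used on the copy of `F₂` labelled by `r`. -/
def freeToTriMat (t : Rˣ) (r : R) : F₂ →* TriMat R :=
  FreeGroup.lift ![⟨1, 0, 1⟩, ⟨t, r, 0⟩]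

theorem freeToTriMat_comp_subtype (t : Rˣ) (r r' : R) :
    (freeToTriMat t r).comp Lam.subtype = (freeToTriMat t r').comp Lam.subtype := by
  have h : Set.EqOn (freeToTriMat t r) (freeToTriMat t r') Lam := by
    refine MonoidHom.eqOn_closure ?_
    rintro _ ⟨n, rfl⟩
    simp only [freeToTriMat, map_mul, map_inv, map_pow, FreeGroup.lift_apply_of,
      Matrix.cons_val_zero, Matrix.cons_val_one, TriMat.mk_zero_col_pow_conj]
  exact MonoidHom.ext fun g => h g.2

/-- The homomorphism of `Gam` to triangular matrices that sends both copies of `s₁` to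
`(1, 0, 1)`, and the copies of `s₂` to `(t, 0, 0)` and `(t, 1, 0)`. -/
def gamToTriMat (t : Rˣ) : Gam →* TriMat R :=
  Monoid.PushoutI.lift (fun i => freeToTriMat t (![0, 1] i)) ((freeToTriMat t 0).comp Lam.subtype)
    fun _ => freeToTriMat_comp_subtype _ _ _

theorem gamToTriMat_gen_zero (t : Rˣ) (i : Fin 2) : gamToTriMat t (gen i 0) = ⟨1, 0, 1⟩ := by
  rw [gamToTriMat, gen, Monoid.PushoutI.lift_of]
  simp [freeToTriMat]

theorem gamToTriMat_gen_one (t : Rˣ) (i : Fin 2) :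
    gamToTriMat t (gen i 1) = ⟨t, ![0, 1] i, 0⟩ := by
  rw [gamToTriMat, gen, Monoid.PushoutI.lift_of]
  simp [freeToTriMat]

theorem gamToTriMat_torusElt (t : Rˣ) (n : ℕ) :
    gamToTriMat t (torusElt n) = ⟨1, -∑ i ∈ Finset.range n, (t : R) ^ i, 0⟩ := by
  rw [torusElt, map_mul, map_inv, map_pow, map_pow, gamToTriMat_gen_one, gamToTriMat_gen_one,
    TriMat.mk_zero_col_pow, TriMat.mk_zero_col_pow]
  ext <;> simp [mul_assoc, ← mul_pow]

/-- The 2-cocycle on `Gam` obtained from the corner cocycle and a functional on `R`. -/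
def gamCocycle (t : Rˣ) (l : R →ₗ[ℤ] ℤ) (p : Gam × Gam) : ℤ :=
  l (TriMat.cornerCocycle (gamToTriMat t p.1) (gamToTriMat t p.2))

theorem gamCocycle_mem_cocycles₂ (t : Rˣ) (l : R →ₗ[ℤ] ℤ) :
    gamCocycle t l ∈ groupCohomology.cocycles₂ (Rep.trivial ℤ Gam ℤ) := by
  rw [trivial_mem_cocycles₂_iff]
  intro g h j
  simp only [gamCocycle, map_mul, ← map_add, TriMat.cornerCocycle_mul_left]

/-- On `torusElt n` and `gen 0 0` the corner cocycle is minus the geometric sum in one order and `0`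
in the other; symmetry makes `l` kill these sums, and successive differences are the powers of `t`.
-/
theorem apply_pow_eq_zero_of_gamCocycle_mem_coboundaries₂ {t : Rˣ} {l : R →ₗ[ℤ] ℤ}
    (h : gamCocycle t l ∈ groupCohomology.coboundaries₂ (Rep.trivial ℤ Gam ℤ)) (n : ℕ) :
    l ((t : R) ^ n) = 0 := by
  have hsum (n : ℕ) : l (∑ i ∈ Finset.range n, (t : R) ^ i) = 0 := by
    simpa [gamCocycle, TriMat.cornerCocycle, gamToTriMat_torusElt, gamToTriMat_gen_zero] using
      apply_comm_of_mem_coboundaries₂ h (commute_torusElt n)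
  simpa [Finset.sum_range_succ, hsum n] using hsum (n + 1)

end Representation

open LaurentPolynomial in
/-- The functional on Laurent polynomials that sends `T n` to the `n`-th entry of a vector. -/
noncomputable def laurentFunctional : (ℕ →₀ ℤ) →ₗ[ℤ] (ℤ[T;T⁻¹] →ₗ[ℤ] ℤ) :=
  Finsupp.linearCombination ℤ fun n : ℕ =>
    Finsupp.lapply (n : ℤ) ∘ₗ (AddMonoidAlgebra.coeffLinearEquiv ℤ).toLinearMap

theorem laurentFunctional_T (x : ℕ →₀ ℤ) (n : ℕ) :
    laurentFunctional x (LaurentPolynomial.T n) = x n := by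
  simp [laurentFunctional, Finsupp.linearCombination_apply, Finsupp.sum, LinearMap.sum_apply, eq_comm]

theorem hasLocallyZeroCocycles_Gam : HasLocallyZeroCocycles Gam := by
  -- `T` is a unit with linearly independent powers, so a functional can take prescribed values on
  -- them.
  let t : (LaurentPolynomial ℤ)ˣ :=
    ⟨LaurentPolynomial.T 1, LaurentPolynomial.T (-1), by rw [← LaurentPolynomial.T_add, add_neg_cancel, LaurentPolynomial.T_zero],
      by rw [← LaurentPolynomial.T_add, neg_add_cancel, LaurentPolynomial.T_zero]⟩
  refine hasLocallyZeroCocycles_of_linearMap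
    { toFun x := gamCocycle t (laurentFunctional x)
      map_add' x y := funext fun p => by simp [gamCocycle]
      map_smul' c x := funext fun p => by simp [gamCocycle] }
    (fun x => gamCocycle_mem_cocycles₂ t _) fun x hx => Finsupp.ext fun n => ?_
  have h := apply_pow_eq_zero_of_gamCocycle_mem_coboundaries₂ hx n
  rwa [LaurentPolynomial.T_pow, mul_one, laurentFunctional_T] at h

end AmalgamCohomology

theorem mainTheorem12 :
    (Group.FG AmalgamCohomology.Gam ∧
      AmalgamCohomology.HasLocallyZeroCocycles AmalgamCohomology.Gam ∧
      ¬ Function.Surjective (AmalgamCohomology.directLimitMap AmalgamCohomology.Gam 2)) ∧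
    (∀ (Γ : Type) [Group Γ], Group.FG Γ → AmalgamCohomology.HasLocallyZeroCocycles Γ →
      ¬ Function.Surjective (AmalgamCohomology.directLimitMap Γ 2)) := by
  have main (Γ : Type) [Group Γ] (hfg : Group.FG Γ)
      (hΓ : AmalgamCohomology.HasLocallyZeroCocycles Γ) :
      ¬ Function.Surjective (AmalgamCohomology.directLimitMap Γ 2) := by
    -- Finite generation enters through countability: `Γ` is a quotient of a countable free group.
    obtain ⟨S, hS, φ, hφ⟩ := Group.fg_iff_exists_freeGroup_hom_surjective.1 hfg
    have := hS.countable.to_subtype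
    have : Countable Γ := hφ.countable
    exact AmalgamCohomology.not_surjective_directLimitMap Γ hΓ
  exact ⟨⟨AmalgamCohomology.fg_Gam, AmalgamCohomology.hasLocallyZeroCocycles_Gam,
    main _ AmalgamCohomology.fg_Gam AmalgamCohomology.hasLocallyZeroCocycles_Gam⟩, main⟩
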